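/- Let $\mathcal C,\mathcal D,\mathcal P$ be categories, let $J:\mathcal C\times\mathcal P\to\mathcal D$ and $K:\mathcal P^{op}\times\mathcal D\to\mathcal C$ be functors with a parametric adjunction $J\dashv_{\mathcal P}K$ (adjunctions $J(-,P)\dashv K(P,-)$ for which the transformations induced by each $p:P\to Q$ are conjugate), and let $S,T,E$ be monads on $\mathcal C,\mathcal D,\mathcal P$ respectively. Write $F^S\dashv U^S$ for the free–forgetful adjunction of the Eilenberg–Moore category $\mathcal C^S$, and similarly for $T$ and $E$. For a functor $B:\mathcal A\to\mathcal B$ and monads $M$ on $\mathcal A$, $N$ on $\mathcal B$, a 1-cell $(B,\psi):(\mathcal A,M)\to(\mathcal B,N)$ of $\mathbf{Mnd}(\mathbf{Cat})$ is given by a natural transformation $\psi:NB\to BM$ with $\psi\circ\mu^NB=B\mu^M\circ\psi M\circ N\psi$ and $\psi\circ\eta^NB=B\eta^M$; it induces the functor $B^\psi:\mathcal A^M\to\mathcal B^N$, $(X,k)\mapsto(BX,\,Bk\circ\psi_X)$. For a 1-cell $(J,\psi):(\mathcal C\times\mathcal P,S\times E)\to(\mathcal D,T)$ put $H(\psi)_{(C,(M,k))}=J(SC,k)\circ\psi_{(C,M)}$,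 which gives a 1-cell $(J(\mathcal C\times U^E),H(\psi)):(\mathcal C\times\mathcal P^E,S\times 1)\to(\mathcal D,T)$; $(J,\psi)$ is (left) Hopf if $H(\psi)$ is invertible. There is a bijection between the following structures. (i) Hopf parametric adjoint liftings: functors $\widehat J:\mathcal C^S\times\mathcal P^E\to\mathcal D^T$ and $\widehat K:(\mathcal P^E)^{op}\times\mathcal D^T\to\mathcal C^S$ with a parametric adjunction $\widehat J\dashv_{\mathcal P^E}\widehat K$ such that $U^T\widehat J=J(U^S\times U^E)$ and $U^S\widehat K=K((U^E)^{op}\times U^T)$, the forgetful functors send the units and counits of $\widehat J\dashv_{\mathcal P^E}\widehat K$ to those of $J\dashv_{\mathcal P}K$, and the 1-cell $(J,\widehat J,\lambda)$ of $\mathbf{Adj}_R(\mathbf{Cat})$ from $F^S\times F^E\dashv U^S\times U^E$ to $F^T\dashv U^T$ is left Hopf. Here $\lambda:F^TJ\to\widehat J(F^S\times F^E)$ is the mate of the identity $J(U^S\times U^E)=U^T\widehat J$, and left Hopf means that $\widehat J(F^S\times\varepsilon)\circ\lambda(\mathcal C\times U^E):F^TJ(\mathcal C\times U^E)\to\widehat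 J(F^S\times\mathcal P^E)$ is invertible, $\varepsilon$ being the counit of $F^E\dashv U^E$. (ii) Hopf parametric adjunctions $(J(\mathcal C\times U^E),H(\psi))\dashv_{\mathcal P^E}(K((U^E)^{op}\times\mathcal D),\mathrm{ad}(H(\psi)))$ in $\mathbf{Mnd}(\mathbf{Cat})$: a left Hopf 1-cell $(J,\psi):(\mathcal C\times\mathcal P,S\times E)\to(\mathcal D,T)$, together with a 1-cell $(K((U^E)^{op}\times\mathcal D),\psi'):((\mathcal P^E)^{op}\times\mathcal D,1\times T)\to(\mathcal C,S)$ whose component $\psi'_{(M,k)}:SK(M,-)\to K(M,T-)$ at each $E$-algebra $(M,k)$ is the mate $\mathrm{ad}(H(\psi)_{(M,k)})$ of the inverse of $H(\psi)_{(M,k)}:TJ(-,M)\to J(S-,M)$ along $J(-,M)\dashv K(M,-)$, such that for each $(M,k)$ the 1-cells $(J(-,M),H(\psi)_{(M,k)})$ and $(K(M,-),\psi'_{(M,k)})$ form an adjoint object in $\mathbf{Mnd}(\mathbf{Cat})$ with the unit and counit of $J(-,M)\dashv K(M,-)$, i.e. this unit and counit are 2-cells of $\mathbf{Mnd}(\mathbf{Cat})$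 (a 2-cell $(A,\alpha)\to(B,\beta)$ between 1-cells $(\mathcal A,M)\to(\mathcal B,N)$ being a natural transformation $\theta:A\to B$ with $\beta\circ N\theta=\theta M\circ\alpha$). The bijection sends a lifting to the structure with $\psi=\Phi(\lambda)=U^T\lambda:TJ\to J(S\times E)$. In the other direction, $\widehat J=[J(\mathcal C\times U^E)]^{H(\psi)}$ and $\widehat K=[K((U^E)^{op}\times\mathcal D)]^{\mathrm{ad}(H(\psi))}$, where $\mathcal C^S\times\mathcal P^E$ and $(\mathcal P^E)^{op}\times\mathcal D^T$ are identified with the categories of algebras of $S\times 1$ and $1\times T$. -/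

import Mathlib

open CategoryTheory CategoryTheory.Functor Opposite

universe v₁ v₂ v₃ v₄ v₅ v₆ u₁ u₂ u₃ u₄ u₅ u₆

namespace HopfParam

noncomputable section

/-- The value `J(f, g) : J(c, p) ⟶ J(c', p')` of a functor on a pair of morphisms. -/
def bimap {C : Type u₁} [Category.{v₁} C] {P : Type u₂} [Category.{v₂} P] {D : Type u₃}
    [Category.{v₃} D] (J : C × P ⥤ D) {c c' : C} {p p' : P} (f : c ⟶ c') (g : p ⟶ p') :
    J.obj (c, p) ⟶ J.obj (c', p') :=
  J.map ((f, g) : ((c, p) : C × P) ⟶ (c', p'))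

theorem bimap_comp {C : Type u₁} [Category.{v₁} C] {P : Type u₂} [Category.{v₂} P] {D : Type u₃}
    [Category.{v₃} D] (J : C × P ⥤ D) {c c' c'' : C} {p p' p'' : P} (f : c ⟶ c') (g : p ⟶ p')
    (f' : c' ⟶ c'') (g' : p' ⟶ p'') :
    bimap J f g ≫ bimap J f' g' = bimap J (f ≫ f') (g ≫ g') :=
  (J.map_comp ((f, g) : ((c, p) : C × P) ⟶ (c', p'))
    ((f', g') : ((c', p') : C × P) ⟶ (c'', p''))).symm

section Products

variable {C : Type u₁} [Category.{v₁} C] {P : Type u₂} [Category.{v₂} P]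
  {X : Type u₃} [Category.{v₃} X] {Q : Type u₄} [Category.{v₄} Q]

/-- The product monad `S × E` on `C × P`. -/
def monadProd (S : Monad C) (E : Monad P) : Monad (C × P) where
  toFunctor := S.toFunctor.prod E.toFunctor
  η :=
    { app := fun x => (S.η.app x.1, E.η.app x.2)
      naturality := fun _ _ f => Prod.ext (S.η.naturality f.1) (E.η.naturality f.2) }
  μ :=
    { app := fun x => (S.μ.app x.1, E.μ.app x.2)
      naturality := fun _ _ f => Prod.ext (S.μ.naturality f.1) (E.μ.naturality f.2) }
  assoc x := Prod.ext (S.assoc x.1) (E.assoc x.2)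
  left_unit x := Prod.ext (S.left_unit x.1) (E.left_unit x.2)
  right_unit x := Prod.ext (S.right_unit x.1) (E.right_unit x.2)

/-- The product adjunction `L × L' ⊣ R × R'`. -/
def adjProd {L : C ⥤ X} {R : X ⥤ C} (a : L ⊣ R) {L' : P ⥤ Q} {R' : Q ⥤ P} (a' : L' ⊣ R') :
    L.prod L' ⊣ R.prod R' where
  unit := { app := fun x => (a.unit.app x.1, a'.unit.app x.2) }
  counit := { app := fun x => (a.counit.app x.1, a'.counit.app x.2) }

/-- A pair of an `S`-algebra and an `E`-algebra, as an algebra of `S × E`. -/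
def algProd (S : Monad C) (E : Monad P) : S.Algebra × E.Algebra ⥤ (monadProd S E).Algebra where
  obj x :=
    { A := (x.1.A, x.2.A)
      a := (x.1.a, x.2.a)
      unit := Prod.ext x.1.unit x.2.unit
      assoc := Prod.ext x.1.assoc x.2.assoc }
  map f :=
    { f := (f.1.f, f.2.f)
      h := Prod.ext f.1.h f.2.h }

/-- The comparison functor from `Q` to the algebras of the identity monad of `Q`. -/
def idAlg (Q : Type u₄) [Category.{v₄} Q] : Q ⥤ (Monad.id Q).Algebra where
  obj q := { A := q, a := 𝟙 q, unit := Category.comp_id _, assoc := rfl }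
  map f := { f := f, h := (Category.comp_id f).trans (Category.id_comp f).symm }

end Products

/-! ### The 2-category of monads -/

section Mnd

variable {C : Type u₁} [Category.{v₁} C] {D : Type u₂} [Category.{v₂} D]
  {P : Type u₃} [Category.{v₃} P]

/-- The structure `ψ : T B ⟶ B S` which makes a functor `B : C ⥤ D` a 1-cell
`(B, ψ) : (C, S) ⟶ (D, T)` of the 2-category of monads. -/
@[ext]
structure MndOneCell (S : Monad C) (T : Monad D) (B : C ⥤ D) where
  psi : B ⋙ T.toFunctor ⟶ S.toFunctor ⋙ B
  mul_compat : ∀ c : C,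
    T.μ.app (B.obj c) ≫ psi.app c =
      T.map (psi.app c) ≫ psi.app (S.obj c) ≫ B.map (S.μ.app c)
  unit_compat : ∀ c : C, T.η.app (B.obj c) ≫ psi.app c = B.map (S.η.app c)

namespace MndOneCell

/-- The identity 1-cell. -/
def id (S : Monad C) : MndOneCell S S (𝟭 C) where
  psi := { app := fun c => 𝟙 (S.obj c) }
  mul_compat c := by simp
  unit_compat c := by simp

/-- Composition of 1-cells: `(B', ψ') (B, ψ) = (B' B, B' ψ ∘ ψ' B)`. -/
def comp {S : Monad C} {T : Monad D} {W : Monad P} {B : C ⥤ D} {B' : D ⥤ P}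
    (f : MndOneCell S T B) (g : MndOneCell T W B') : MndOneCell S W (B ⋙ B') where
  psi :=
    { app := fun c => g.psi.app (B.obj c) ≫ B'.map (f.psi.app c)
      naturality := fun c c' h => by
        have h₁ := g.psi.naturality (B.map h)
        have h₂ := f.psi.naturality h
        simp only [Functor.comp_map, Functor.comp_obj] at h₁ h₂ ⊢
        rw [← Category.assoc, h₁, Category.assoc, Category.assoc, ← B'.map_comp, h₂,
          B'.map_comp] }
  mul_compat c := by
    have h₁ := g.mul_compat (B.obj c)
    have h₂ := f.mul_compat c
    have h₃ := g.psi.naturality (f.psi.app c)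
    simp only [Functor.comp_map, Functor.comp_obj, Functor.map_comp, Category.assoc]
      at h₁ h₂ h₃ ⊢
    rw [← Category.assoc, h₁]
    simp only [Category.assoc]
    rw [← B'.map_comp, h₂]
    simp only [Functor.map_comp]
    rw [← Category.assoc (W.map (B'.map (f.psi.app c))), h₃]
    simp only [Category.assoc]
  unit_compat c := by
    have h₁ := g.unit_compat (B.obj c)
    have h₂ := f.unit_compat c
    simp only [Functor.comp_map, Functor.comp_obj] at h₁ h₂ ⊢
    rw [← Category.assoc, h₁, ← B'.map_comp, h₂]

/-- The lifted functor `B^ψ` on Eilenberg–Moore algebras, which sends `(M, k)` to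
`(B M, B k ∘ ψ M)`. -/
def lift {S : Monad C} {T : Monad D} {B : C ⥤ D} (f : MndOneCell S T B) :
    S.Algebra ⥤ T.Algebra where
  obj M :=
    { A := B.obj M.A
      a := f.psi.app M.A ≫ B.map M.a
      unit := by
        have h := f.unit_compat M.A
        rw [← Category.assoc, h, ← B.map_comp, M.unit]; exact B.map_id _
      assoc := by
        have h₁ := f.mul_compat M.A
        have h₂ := f.psi.naturality M.a
        simp only [Functor.comp_map, Functor.comp_obj] at h₁ h₂
        rw [← Category.assoc, h₁]
        simp only [Category.assoc, Functor.map_comp]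
        rw [← B.map_comp, M.assoc, B.map_comp, ← Category.assoc (T.map (B.map M.a)), h₂]
        simp only [Category.assoc] }
  map {M N} m :=
    { f := B.map m.f
      h := by
        have h₂ := f.psi.naturality m.f
        have h₃ := m.h
        simp only [Functor.comp_map, Functor.comp_obj] at h₂
        change T.map (B.map m.f) ≫ f.psi.app N.A ≫ B.map N.a =
          (f.psi.app M.A ≫ B.map M.a) ≫ B.map m.f
        rw [← Category.assoc, h₂, Category.assoc, Category.assoc, ← B.map_comp, ← B.map_comp, h₃] }
  map_id M := by ext; exact B.map_id _
  map_comp m n := by ext; exact B.map_comp _ _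

end MndOneCell

/-- The 2-cells `θ : (A, ψ^A) ⟶ (B, ψ^B)` of the 2-category of monads. -/
def IsMndTwoCell {S : Monad C} {T : Monad D} {A B : C ⥤ D}
    (f : MndOneCell S T A) (g : MndOneCell S T B) (θ : A ⟶ B) : Prop :=
  ∀ c : C, T.map (θ.app c) ≫ g.psi.app c = f.psi.app c ≫ θ.app (S.obj c)

/-- The 1-cells `f : (C, S) ⟶ (D, T)` and `g : (D, T) ⟶ (C, S)` form an adjoint object
`f ⊣ g` in the 2-category of monads with the unit and counit of `J ⊣ K`
(whose triangular identities are part of `adj`). -/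
structure IsMndAdjointObject {S : Monad C} {T : Monad D} {J : C ⥤ D} {K : D ⥤ C}
    (adj : J ⊣ K) (f : MndOneCell S T J) (g : MndOneCell T S K) : Prop where
  unit_cell : IsMndTwoCell (MndOneCell.id S) (f.comp g) adj.unit
  counit_cell : IsMndTwoCell (g.comp f) (MndOneCell.id T) adj.counit

/-- The adjoint `ad ψ = K T ε ∘ K ψ⁻¹ K ∘ η S K : S K ⟶ K T` of an invertible `ψ : T J ⟶ J S`:
the mate of `ψ⁻¹` along `J ⊣ K`. -/
def ad {S : C ⥤ C} {T : D ⥤ D} {J : C ⥤ D} {K : D ⥤ C} (adj : J ⊣ K)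
    (ψ : J ⋙ T ⟶ S ⋙ J) [IsIso ψ] : K ⋙ S ⟶ T ⋙ K :=
  (mateEquiv adj adj (TwoSquare.mk _ _ _ _ (inv ψ))).natTrans

end Mnd

/-! ### Parametric adjoint objects of monads -/

section Parametric

variable {C : Type u₁} [Category.{v₁} C] {D : Type u₂} [Category.{v₂} D]
  {P : Type u₃} [Category.{v₃} P] {Q : Type u₄} [Category.{v₄} Q]

/-- A parametric adjunction `J ⊣_P K` between `J : C × P ⥤ D` and `K : Pᵒᵖ × D ⥤ C`: adjunctions
`J(-, p) ⊣ K(p, -)` for which the transformations induced by each `p ⟶ p'` are conjugate. -/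
abbrev ParamAdj (J : C × P ⥤ D) (K : Pᵒᵖ × D ⥤ C) :=
  (curry.obj J).flip ⊣₂ curry.obj K

/-- The functor `J(-, p)`. -/
abbrev fixR (J : C × P ⥤ D) (p : P) : C ⥤ D := (curry.obj J).flip.obj p

/-- The functor `K(p, -)`. -/
abbrev fixL (K : Pᵒᵖ × D ⥤ C) (p : P) : D ⥤ C := (curry.obj K).obj (op p)

/-- Restriction along `U : Q ⥤ P`: if `J ⊣_P K` then `J(C × U) ⊣_Q K(Uᵒᵖ × D)`. -/
def ParamAdj.restrict {J : C × P ⥤ D} {K : Pᵒᵖ × D ⥤ C} (a : ParamAdj J K) (U : Q ⥤ P) :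
    ParamAdj ((𝟭 C).prod U ⋙ J) (U.op.prod (𝟭 D) ⋙ K) where
  adj q :=
    { unit :=
        { app := fun c => (a.adj (U.obj q)).unit.app c
          naturality := fun c c' f => by
            have h := (a.adj (U.obj q)).unit.naturality f
            simpa using h }
      counit :=
        { app := fun d => (a.adj (U.obj q)).counit.app d
          naturality := fun d d' f => by
            have h := (a.adj (U.obj q)).counit.naturality f
            simpa using h }
      left_triangle_components := fun c => by
        have h := (a.adj (U.obj q)).left_triangle_components c
        simpa using h
      right_triangle_components := fun d => by
        have h := (a.adj (U.obj q)).right_triangle_components d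
        simpa using h }
  unit_whiskerRight_map {q q'} f := by
    ext c
    have h := NatTrans.congr_app (a.unit_whiskerRight_map (U.map f)) c
    simpa using h

/-- The 1-cell `(A(-, q), α(-, q)) : (C, S) ⟶ (D, T)` obtained from
`(A, α) : (C × Q, S × 1) ⟶ (D, T)`. -/
def MndOneCell.fixRight {S : Monad C} {T : Monad D} {A : C × Q ⥤ D}
    (α : MndOneCell (monadProd S (Monad.id Q)) T A) (q : Q) : MndOneCell S T (fixR A q) where
  psi :=
    { app := fun c => α.psi.app (c, q)
      naturality := fun c c' f => α.psi.naturality ((f, 𝟙 q) : ((c, q) : C × Q) ⟶ (c', q)) }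
  mul_compat c := α.mul_compat (c, q)
  unit_compat c := α.unit_compat (c, q)

/-- The 1-cell `(B(q, -), β(q, -)) : (D, T) ⟶ (C, S)` obtained from
`(B, β) : (Qᵒᵖ × D, 1 × T) ⟶ (C, S)`. -/
def MndOneCell.fixLeft {S : Monad C} {T : Monad D} {B : Qᵒᵖ × D ⥤ C}
    (β : MndOneCell (monadProd (Monad.id Qᵒᵖ) T) S B) (q : Q) : MndOneCell T S (fixL B q) where
  psi :=
    { app := fun d => β.psi.app (op q, d)
      naturality := fun d d' f =>
        β.psi.naturality ((𝟙 (op q), f) : ((op q, d) : Qᵒᵖ × D) ⟶ (op q, d')) }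
  mul_compat d := β.mul_compat (op q, d)
  unit_compat d := β.unit_compat (op q, d)

/-- A parametric adjoint object `(A, α) ⊣_Q (B, β)` in the 2-category of monads, over the
parametric adjunction `A ⊣_Q B`: for every `q`, the 1-cells `(A(-, q), α(-, q))` and
`(B(q, -), β(q, -))` form an adjoint object with the unit and counit of `A(-, q) ⊣ B(q, -)`. -/
def IsMndParamAdjointObject {S : Monad C} {T : Monad D} {A : C × Q ⥤ D} {B : Qᵒᵖ × D ⥤ C}
    (a : ParamAdj A B) (α : MndOneCell (monadProd S (Monad.id Q)) T A)
    (β : MndOneCell (monadProd (Monad.id Qᵒᵖ) T) S B) : Prop :=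
  ∀ q : Q, IsMndAdjointObject (a.adj q) (α.fixRight q) (β.fixLeft q)

section PsiAt

variable {S : Monad C} {T : Monad D} {E : Monad P} {J : C × P ⥤ D}
  (f : MndOneCell (monadProd S E) T J)

/-- The component `ψ (c, p) : T J(c, p) ⟶ J(S c, E p)`. -/
def MndOneCell.psiAt (c : C) (p : P) : T.obj (J.obj (c, p)) ⟶ J.obj (S.obj c, E.obj p) :=
  f.psi.app (c, p)

theorem MndOneCell.psiAt_naturality {c c' : C} {p p' : P} (g : c ⟶ c') (h : p ⟶ p') :
    T.map (bimap J g h) ≫ f.psiAt c' p' = f.psiAt c p ≫ bimap J (S.map g) (E.map h) :=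
  f.psi.naturality ((g, h) : ((c, p) : C × P) ⟶ (c', p'))

theorem MndOneCell.psiAt_mul (c : C) (p : P) :
    T.μ.app (J.obj (c, p)) ≫ f.psiAt c p =
      T.map (f.psiAt c p) ≫ f.psiAt (S.obj c) (E.obj p) ≫ bimap J (S.μ.app c) (E.μ.app p) :=
  f.mul_compat (c, p)

theorem MndOneCell.psiAt_unit (c : C) (p : P) :
    T.η.app (J.obj (c, p)) ≫ f.psiAt c p = bimap J (S.η.app c) (E.η.app p) :=
  f.unit_compat (c, p)

/-- The left Hopf operator `(J(C × U^E), H(ψ)) : (C × P^E, S × 1) ⟶ (D, T)` of a 1-cell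
`(J, ψ) : (C × P, S × E) ⟶ (D, T)`, where `H(ψ) = J(S × U^E ε) ∘ ψ(C × U^E)`, so that
`H(ψ)` at `(c, (M, k))` is `J(S c, k) ∘ ψ (c, M)`. -/
def MndOneCell.hopf :
    MndOneCell (monadProd S (Monad.id E.Algebra)) T ((𝟭 C).prod E.forget ⋙ J) where
  psi :=
    { app := fun x => f.psiAt x.1 x.2.A ≫ bimap J (𝟙 (S.obj x.1)) x.2.a
      naturality := fun x y g => by
        have h₂ : E.map g.2.f ≫ y.2.a = x.2.a ≫ g.2.f := g.2.h
        change T.map (bimap J g.1 g.2.f) ≫ f.psiAt y.1 y.2.A ≫ bimap J (𝟙 (S.obj y.1)) y.2.a =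
          (f.psiAt x.1 x.2.A ≫ bimap J (𝟙 (S.obj x.1)) x.2.a) ≫ bimap J (S.map g.1) g.2.f
        rw [← Category.assoc, f.psiAt_naturality, Category.assoc, Category.assoc, bimap_comp,
          bimap_comp, h₂, Category.comp_id, Category.id_comp] }
  mul_compat x := by
    change T.μ.app (J.obj (x.1, x.2.A)) ≫ f.psiAt x.1 x.2.A ≫ bimap J (𝟙 (S.obj x.1)) x.2.a =
      T.map (f.psiAt x.1 x.2.A ≫ bimap J (𝟙 (S.obj x.1)) x.2.a) ≫
        (f.psiAt (S.obj x.1) x.2.A ≫ bimap J (𝟙 (S.obj (S.obj x.1))) x.2.a) ≫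
          bimap J (S.μ.app x.1) (𝟙 x.2.A)
    rw [← Category.assoc, f.psiAt_mul, T.map_comp]
    simp only [Category.assoc]
    rw [← Category.assoc (T.map (bimap J _ _)), f.psiAt_naturality]
    simp only [Category.assoc]
    rw [bimap_comp, bimap_comp, bimap_comp]
    simp [x.2.assoc]
  unit_compat x := by
    change T.η.app (J.obj (x.1, x.2.A)) ≫ f.psiAt x.1 x.2.A ≫ bimap J (𝟙 (S.obj x.1)) x.2.a =
      bimap J (S.η.app x.1) (𝟙 x.2.A)
    rw [← Category.assoc, f.psiAt_unit, bimap_comp, x.2.unit, Category.comp_id]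

end PsiAt

/-- A 1-cell `(J, ψ) : (C × P, S × E) ⟶ (D, T)` of the 2-category of monads is left Hopf if
`H(ψ)` is invertible. -/
def MndOneCell.IsHopf {S : Monad C} {T : Monad D} {E : Monad P} {J : C × P ⥤ D}
    (f : MndOneCell (monadProd S E) T J) : Prop :=
  IsIso f.hopf.psi

/-- If `H(ψ)` is invertible, then so are its restrictions `H(ψ)(-, N) : T J(-, N) ⟶ J(S -, N)`. -/
theorem MndOneCell.IsHopf.fixRight {S : Monad C} {T : Monad D} {E : Monad P} {J : C × P ⥤ D}
    {f : MndOneCell (monadProd S E) T J} (h : f.IsHopf) (N : E.Algebra) :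
    IsIso (f.hopf.fixRight N).psi := by
  have h' : IsIso f.hopf.psi := h
  have (c : C) : IsIso ((f.hopf.fixRight N).psi.app c) :=
    inferInstanceAs (IsIso (f.hopf.psi.app (c, N)))
  exact NatIso.isIso_of_isIso_app _

end Parametric

/-! ### The 2-category of adjunctions -/

section Adj

variable {C : Type u₁} [Category.{v₁} C] {X : Type u₂} [Category.{v₂} X]
  {D : Type u₃} [Category.{v₃} D] {Y : Type u₄} [Category.{v₄} Y]
  {P : Type u₅} [Category.{v₅} P] {Q : Type u₆} [Category.{v₆} Q]

/-- The mate `ρ : J R ⟶ R' V` of `λ : L' J ⟶ V L`. -/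
abbrev mate {L : C ⥤ X} {R : X ⥤ C} (a : L ⊣ R) {L' : D ⥤ Y} {R' : Y ⥤ D} (a' : L' ⊣ R')
    {J : C ⥤ D} {V : X ⥤ Y} (lam : J ⋙ L' ⟶ L ⋙ V) : R ⋙ J ⟶ V ⋙ R' :=
  (mateEquiv a a' (TwoSquare.mk _ _ _ _ lam)).natTrans

/-- The structure `λ : L' J ⟶ V L` which makes a pair of functors `J : C ⥤ D`, `V : X ⥤ Y` a
1-cell `(J, V, λ)` from `L ⊣ R` to `L' ⊣ R'` in the 2-category of adjunctions: the mate
`ρ : J R ⟶ R' V` of `λ` is invertible. -/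
@[ext]
structure AdjOneCell {L : C ⥤ X} {R : X ⥤ C} (a : L ⊣ R) {L' : D ⥤ Y} {R' : Y ⥤ D}
    (a' : L' ⊣ R') (J : C ⥤ D) (V : X ⥤ Y) where
  lam : J ⋙ L' ⟶ L ⋙ V
  isIso_mate : IsIso (mate a a' lam)

namespace AdjOneCell

/-- The mate `ρ : J R ⟶ R' V` of `λ`, as an isomorphism. -/
def rho {L : C ⥤ X} {R : X ⥤ C} {a : L ⊣ R} {L' : D ⥤ Y} {R' : Y ⥤ D}
    {a' : L' ⊣ R'} {J : C ⥤ D} {V : X ⥤ Y} (f : AdjOneCell a a' J V) : R ⋙ J ≅ V ⋙ R' :=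
  haveI := f.isIso_mate
  asIso (mate a a' f.lam)

/-- The transformation `Φ(λ) = ρ⁻¹ L ∘ R' λ : R' L' J ⟶ J R L`. -/
def phi {L : C ⥤ X} {R : X ⥤ C} {a : L ⊣ R} {L' : D ⥤ Y} {R' : Y ⥤ D}
    {a' : L' ⊣ R'} {J : C ⥤ D} {V : X ⥤ Y} (f : AdjOneCell a a' J V) :
    J ⋙ L' ⋙ R' ⟶ (L ⋙ R) ⋙ J :=
  (associator J L' R').inv ≫ whiskerRight f.lam R' ≫ (associator L V R').hom ≫
    whiskerLeft L f.rho.inv ≫ (associator L R J).inv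

section LamAt

variable {L : C ⥤ X} {R : X ⥤ C} {a : L ⊣ R} {Lt : P ⥤ Q} {Rt : Q ⥤ P} {b : Lt ⊣ Rt}
  {L' : D ⥤ Y} {R' : Y ⥤ D} {a' : L' ⊣ R'} {J : C × P ⥤ D} {V : X × Q ⥤ Y}
  (f : AdjOneCell (adjProd a b) a' J V)

/-- The component `λ (c, p) : L' J(c, p) ⟶ V(L c, L̃ p)`. -/
def lamAt (c : C) (p : P) : L'.obj (J.obj (c, p)) ⟶ V.obj (L.obj c, Lt.obj p) :=
  f.lam.app (c, p)

theorem lamAt_naturality {c c' : C} {p p' : P} (g : c ⟶ c') (h : p ⟶ p') :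
    L'.map (bimap J g h) ≫ f.lamAt c' p' = f.lamAt c p ≫ bimap V (L.map g) (Lt.map h) :=
  f.lam.naturality ((g, h) : ((c, p) : C × P) ⟶ (c', p'))

/-- For a 1-cell `(J, V, λ)` from `L × L̃ ⊣ R × R̃` to `L' ⊣ R'`, the transformation
`H(λ) = V(L × ε) ∘ λ(C × R̃) : L' J (C × R̃) ⟶ V (L × Q)` of its left Hopf operator, where `ε` is
the counit of `L̃ ⊣ R̃`. -/
def hopf : ((𝟭 C).prod Rt ⋙ J) ⋙ L' ⟶ L.prod (𝟭 Q) ⋙ V where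
  app x := f.lamAt x.1 (Rt.obj x.2) ≫ bimap V (𝟙 (L.obj x.1)) (b.counit.app x.2)
  naturality x y g := by
    change L'.map (bimap J g.1 (Rt.map g.2)) ≫ f.lamAt y.1 (Rt.obj y.2) ≫
        bimap V (𝟙 (L.obj y.1)) (b.counit.app y.2) =
      (f.lamAt x.1 (Rt.obj x.2) ≫ bimap V (𝟙 (L.obj x.1)) (b.counit.app x.2)) ≫
        bimap V (L.map g.1) g.2
    rw [← Category.assoc, f.lamAt_naturality, Category.assoc, Category.assoc, bimap_comp,
      bimap_comp, Category.comp_id, Category.id_comp]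
    congr 2
    exact b.counit.naturality g.2

end LamAt

/-- A 1-cell `(J, V, λ)` from `L × L̃ ⊣ R × R̃` to `L' ⊣ R'` is left Hopf if `H(λ)` is
invertible. -/
def IsHopf {L : C ⥤ X} {R : X ⥤ C} {a : L ⊣ R} {Lt : P ⥤ Q} {Rt : Q ⥤ P} {b : Lt ⊣ Rt}
    {L' : D ⥤ Y} {R' : Y ⥤ D} {a' : L' ⊣ R'} {J : C × P ⥤ D} {V : X × Q ⥤ Y}
    (f : AdjOneCell (adjProd a b) a' J V) : Prop :=
  IsIso f.hopf

/-- A strictly commutative square `R' V = J R` as a 1-cell of the 2-category of adjunctions: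
`ρ` is the identity and `λ` is its mate. -/
def ofComm {L : C ⥤ X} {R : X ⥤ C} (a : L ⊣ R) {L' : D ⥤ Y} {R' : Y ⥤ D} (a' : L' ⊣ R')
    {J : C ⥤ D} {V : X ⥤ Y} (h : V ⋙ R' = R ⋙ J) : AdjOneCell a a' J V where
  lam := ((mateEquiv a a').symm (TwoSquare.mk _ _ _ _ (eqToHom h.symm))).natTrans
  isIso_mate := by
    have h' : mate a a' ((mateEquiv a a').symm (TwoSquare.mk _ _ _ _ (eqToHom h.symm))).natTrans =
        eqToHom h.symm :=
      congrArg TwoSquare.natTrans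
        ((mateEquiv a a').apply_symm_apply (TwoSquare.mk _ _ _ _ (eqToHom h.symm)))
    rw [h']
    infer_instance

end AdjOneCell

end Adj

/-! ### The two structures -/

section Main

variable {C : Type u₁} [Category.{v₁} C] {D : Type u₂} [Category.{v₂} D]
  {P : Type u₃} [Category.{v₃} P]

/-- Hopf parametric adjoint liftings of `J ⊣_P K` to Eilenberg–Moore categories: a parametric
adjunction `Ĵ ⊣_{P^E} K̂` with `U^T Ĵ = J(U^S × U^E)` and `U^S K̂ = K((U^E)ᵒᵖ × U^T)`, whose units
and counits lie over those of `J ⊣_P K`, and for which the 1-cell `(J, Ĵ, λ)` is left Hopf. -/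
structure HopfParamLifting (S : Monad C) (E : Monad P) (T : Monad D) {J : C × P ⥤ D}
    {K : Pᵒᵖ × D ⥤ C} (a : ParamAdj J K) where
  Jhat : S.Algebra × E.Algebra ⥤ T.Algebra
  Khat : E.Algebraᵒᵖ × T.Algebra ⥤ S.Algebra
  adjHat : ParamAdj Jhat Khat
  commJ : Jhat ⋙ T.forget = S.forget.prod E.forget ⋙ J
  commK : Khat ⋙ S.forget = E.forget.op.prod T.forget ⋙ K
  unit_lift : ∀ (M : S.Algebra) (N : E.Algebra),
    ((adjHat.adj N).unit.app M).f =
      (a.adj N.A).unit.app M.A ≫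
        (fixL K N.A).map ((eqToHom commJ.symm).app (M, N)) ≫
        (eqToHom commK.symm).app (op N, Jhat.obj (M, N))
  counit_lift : ∀ (N : E.Algebra) (Y : T.Algebra),
    (eqToHom commJ.symm).app (Khat.obj (op N, Y), N) ≫ ((adjHat.adj N).counit.app Y).f =
      (fixR J N.A).map ((eqToHom commK).app (op N, Y)) ≫ (a.adj N.A).counit.app Y.A
  hopf : (AdjOneCell.ofComm (adjProd S.adj E.adj) T.adj commJ).IsHopf

/-- The 1-cell `(J, Ĵ, λ)` of a lifting, from `F^S × F^E ⊣ U^S × U^E` to `F^T ⊣ U^T`. -/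
def HopfParamLifting.oneCell {S : Monad C} {E : Monad P} {T : Monad D} {J : C × P ⥤ D}
    {K : Pᵒᵖ × D ⥤ C} {a : ParamAdj J K} (l : HopfParamLifting S E T a) :
    AdjOneCell (adjProd S.adj E.adj) T.adj J l.Jhat :=
  AdjOneCell.ofComm (adjProd S.adj E.adj) T.adj l.commJ

/-- Hopf parametric adjunctions
`(J(C × U^E), H(ψ)) ⊣_{P^E} (K((U^E)ᵒᵖ × D), ad(H(ψ)))` in the 2-category of monads, over the
parametric adjunction `J(C × U^E) ⊣_{P^E} K((U^E)ᵒᵖ × D)` obtained from `J ⊣_P K` by restriction: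
a left Hopf 1-cell `(J, ψ)` and a 1-cell `(K((U^E)ᵒᵖ × D), ψ')` with `ψ' = ad(H(ψ))` which forms a
parametric adjoint object with `(J(C × U^E), H(ψ))`. -/
structure HopfParamAdjunction (S : Monad C) (E : Monad P) (T : Monad D) {J : C × P ⥤ D}
    {K : Pᵒᵖ × D ⥤ C} (a : ParamAdj J K) where
  cell : MndOneCell (monadProd S E) T J
  isHopf : cell.IsHopf
  cocell : MndOneCell (monadProd (Monad.id E.Algebraᵒᵖ) T) S (E.forget.op.prod (𝟭 D) ⋙ K)
  cocell_eq : ∀ N : E.Algebra,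
    haveI := isHopf.fixRight N
    (cocell.fixLeft N).psi = ad ((a.restrict E.forget).adj N) (cell.hopf.fixRight N).psi
  adjoint : IsMndParamAdjointObject (a.restrict E.forget) cell.hopf cocell

end Main

end

end HopfParam

/-!
A functor into `T`-algebras lying strictly over `B` is the same thing as an action of `T` on `B`
(`MonadAction`). If `B = B' U^W`, such an action is determined by its values on free
`W`-algebras, and is therefore the same thing as a 1-cell `(B', ψ)` of the 2-category of monads
(`MonadAction.toCell`). For `W = S × E` the lifted functor is the one induced by `H(ψ)`, since acting
by `J(C, k)` and then by `J(m, M)` is acting by `J(m, k)` (`MndOneCell.hopfLift_eq`). So the functors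
`Ĵ` and `K̂` of a lifting are exactly the functors induced by a 1-cell on `J` and a 1-cell on
`K((U^E)ᵒᵖ × D)`.

A natural transformation is a 2-cell of monads if and only if its components are morphisms between
the lifted algebras, as one sees on free algebras. Hence an adjunction `Ĵ(-, N) ⊣ K̂(N, -)`
over `J(-, U^E N) ⊣ K(U^E N, -)` amounts to an adjoint object of monads (`IsMndAdjointObject.liftAdj`,
`IsMndAdjointObject.of_algebra_hom`), in which the unit condition alone forces the right adjoint to
carry the mate of the inverse of `H(ψ)` (`IsMndAdjointObject.psi_eq_ad`). Finally, the transformation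
underlying `λ` is `ψ`, so that `U^T H(λ) = H(ψ)`, and the two Hopf conditions agree because
`U^T` reflects isomorphisms (`isHopf_ofComm_hopfLift_iff`).

Both structures carry redundant data: a lifting is determined by its two functors, and a Hopf
parametric adjunction of monads by `ψ`. This gives surjectivity and injectivity of the passage from
adjunctions of monads to liftings.
-/

namespace HopfParam

noncomputable section

/-! ### Actions of a monad on a functor -/

section Action

variable {X : Type u₁} [Category.{v₁} X] {D : Type u₂} [Category.{v₂} D]
  {C : Type u₃} [Category.{v₃} C] {Y : Type u₄} [Category.{v₄} Y]

/-- An action of a monad `T` on a functor `B : X ⥤ D`: a functorial choice of `T`-algebra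
structures on the objects `B x`. -/
@[ext]
structure MonadAction (T : Monad D) (B : X ⥤ D) where
  act : B ⋙ T.toFunctor ⟶ B
  unit : ∀ x, T.η.app (B.obj x) ≫ act.app x = 𝟙 (B.obj x)
  assoc : ∀ x, T.μ.app (B.obj x) ≫ act.app x = T.map (act.app x) ≫ act.app x

namespace MonadAction

/-- The functor to the category of algebras given by an action. -/
def toFunctor {T : Monad D} {B : X ⥤ D} (α : MonadAction T B) : X ⥤ T.Algebra where
  obj x := { A := B.obj x, a := α.act.app x, unit := α.unit x, assoc := α.assoc x }
  map f := { f := B.map f, h := α.act.naturality f }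
  map_id x := by ext; exact B.map_id x
  map_comp f g := by ext; exact B.map_comp f g

/-- The action carried by the underlying objects of a functor to the category of algebras. -/
def ofFunctor {T : Monad D} (G : X ⥤ T.Algebra) : MonadAction T (G ⋙ T.forget) where
  act := { app := fun x => (G.obj x).a, naturality := fun _ _ f => (G.map f).h }
  unit x := (G.obj x).unit
  assoc x := (G.obj x).assoc

/-- A functor to algebras which lies over `B` is, on the nose, the one given by an action on `B`.
This replaces an equation between functors by a definitional one. -/
theorem exists_eq_toFunctor {T : Monad D} {B : X ⥤ D} (G : X ⥤ T.Algebra)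
    (h : G ⋙ T.forget = B) : ∃ α : MonadAction T B, G = α.toFunctor := by
  subst h
  exact ⟨ofFunctor G, rfl⟩

/-- Restriction of an action along a functor. -/
def precomp {T : Monad D} {B : X ⥤ D} (α : MonadAction T B) (H : Y ⥤ X) :
    MonadAction T (H ⋙ B) where
  act := { app := fun y => α.act.app (H.obj y), naturality := fun _ _ _ => α.act.naturality _ }
  unit _ := α.unit _
  assoc _ := α.assoc _

/-- The action on `B U^W` at the free algebra on `c`, with its carrier written as `B W c`. -/
def freeAct {W : Monad C} {T : Monad D} {B : C ⥤ D} (α : MonadAction T (W.forget ⋙ B)) (c : C) :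
    T.obj (B.obj (W.obj c)) ⟶ B.obj (W.obj c) :=
  α.act.app (W.free.obj c)

/-- An action of `T` on `B U^W` is the same thing as a 1-cell `(B, ψ) : (C, W) ⟶ (D, T)`; here
`ψ` is the action at the free algebras, precomposed with `T B η`. -/
def toCell {W : Monad C} {T : Monad D} {B : C ⥤ D} (α : MonadAction T (W.forget ⋙ B)) :
    MndOneCell W T B where
  psi :=
    { app := fun c => T.map (B.map (W.η.app c)) ≫ α.freeAct c
      naturality := fun c c' f => by
        have h₁ : T.map (B.map (W.map f)) ≫ α.freeAct c' = α.freeAct c ≫ B.map (W.map f) :=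
          α.act.naturality (W.free.map f)
        have h₂ : f ≫ W.η.app c' = W.η.app c ≫ W.map f := W.η.naturality f
        change T.map (B.map f) ≫ T.map (B.map (W.η.app c')) ≫ α.freeAct c' =
          (T.map (B.map (W.η.app c)) ≫ α.freeAct c) ≫ B.map (W.map f)
        rw [Category.assoc, ← h₁, ← T.map_comp_assoc, ← B.map_comp, h₂, B.map_comp,
          T.map_comp_assoc] }
  mul_compat c := by
    -- The multiplication of `W` is a morphism of algebras from the free algebra on `W c`.
    have h₁ : T.map (B.map (W.μ.app c)) ≫ α.freeAct c =
        α.freeAct (W.obj c) ≫ B.map (W.μ.app c) :=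
      α.act.naturality
        ({ f := W.μ.app c, h := W.assoc c } : W.free.obj (W.obj c) ⟶ W.free.obj c)
    have h₂ : T.μ.app (B.obj (W.obj c)) ≫ α.freeAct c =
        T.map (α.freeAct c) ≫ α.freeAct c := α.assoc (W.free.obj c)
    have h₃ : T.μ.app (B.obj c) ≫ T.map (B.map (W.η.app c)) =
        T.map (T.map (B.map (W.η.app c))) ≫ T.μ.app (B.obj (W.obj c)) :=
      (T.μ.naturality (B.map (W.η.app c))).symm
    have h₄ : T.map (B.map (W.η.app (W.obj c))) ≫ T.map (B.map (W.μ.app c)) =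
        𝟙 (T.obj (B.obj (W.obj c))) := by
      rw [← T.map_comp, ← B.map_comp, W.left_unit]
      exact (congrArg T.map (B.map_id _)).trans (T.map_id _)
    change T.μ.app (B.obj c) ≫ T.map (B.map (W.η.app c)) ≫ α.freeAct c =
      T.map (T.map (B.map (W.η.app c)) ≫ α.freeAct c) ≫
        (T.map (B.map (W.η.app (W.obj c))) ≫ α.freeAct (W.obj c)) ≫ B.map (W.μ.app c)
    rw [Category.assoc, ← h₁, reassoc_of% h₄, reassoc_of% h₃, h₂, T.map_comp, Category.assoc]
  unit_compat c := by
    have h₁ : T.η.app (B.obj (W.obj c)) ≫ α.freeAct c = 𝟙 (B.obj (W.obj c)) :=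
      α.unit (W.free.obj c)
    have h₂ : T.η.app (B.obj c) ≫ T.map (B.map (W.η.app c)) =
        B.map (W.η.app c) ≫ T.η.app (B.obj (W.obj c)) :=
      (T.η.naturality (B.map (W.η.app c))).symm
    change T.η.app (B.obj c) ≫ T.map (B.map (W.η.app c)) ≫ α.freeAct c = B.map (W.η.app c)
    rw [reassoc_of% h₂, h₁]
    exact Category.comp_id _

theorem toCell_psi_comp_map {W : Monad C} {T : Monad D} {B : C ⥤ D}
    (α : MonadAction T (W.forget ⋙ B)) (M : W.Algebra) :
    α.toCell.psi.app M.A ≫ B.map M.a = α.act.app M := by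
  have h₁ : T.map (B.map M.a) ≫ α.act.app M = α.freeAct M.A ≫ B.map M.a :=
    α.act.naturality ({ f := M.a, h := M.assoc.symm } : W.free.obj M.A ⟶ M)
  have h₂ : T.map (B.map (W.η.app M.A)) ≫ T.map (B.map M.a) = 𝟙 (T.obj (B.obj M.A)) := by
    rw [← T.map_comp, ← B.map_comp, M.unit]
    exact (congrArg T.map (B.map_id _)).trans (T.map_id _)
  change (T.map (B.map (W.η.app M.A)) ≫ α.freeAct M.A) ≫ B.map M.a = _
  rw [Category.assoc, ← h₁]
  exact (Category.assoc _ _ _).symm.trans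
    ((congrArg (· ≫ α.act.app M) h₂).trans (Category.id_comp _))

end MonadAction

end Action

/-! ### Adjoint objects of monads and adjunctions on algebras -/

section Mnd

variable {C : Type u₁} [Category.{v₁} C] {D : Type u₂} [Category.{v₂} D]

theorem IsMndTwoCell.lift_map {S : Monad C} {T : Monad D} {A B : C ⥤ D} {f : MndOneCell S T A}
    {g : MndOneCell S T B} {θ : A ⟶ B} (h : IsMndTwoCell f g θ) (M : S.Algebra) :
    T.map (θ.app M.A) ≫ g.psi.app M.A ≫ B.map M.a =
      (f.psi.app M.A ≫ A.map M.a) ≫ θ.app M.A := by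
  rw [← Category.assoc, h M.A, Category.assoc, Category.assoc, θ.naturality]

/-- A transformation whose components at all algebras are morphisms between the lifted algebras is
a 2-cell: test it on free algebras. -/
theorem isMndTwoCell_of_free {S : Monad C} {T : Monad D} {A B : C ⥤ D} (f : MndOneCell S T A)
    (g : MndOneCell S T B) (θ : A ⟶ B)
    (h : ∀ c : C, T.map (θ.app (S.obj c)) ≫ g.psi.app (S.obj c) ≫ B.map (S.μ.app c) =
      (f.psi.app (S.obj c) ≫ A.map (S.μ.app c)) ≫ θ.app (S.obj c)) : IsMndTwoCell f g θ := by
  -- A 1-cell is recovered from its lift at free algebras.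
  have key (F : C ⥤ D) (k : MndOneCell S T F) (c : C) : k.psi.app c =
      T.map (F.map (S.η.app c)) ≫ k.psi.app (S.obj c) ≫ F.map (S.μ.app c) := by
    have h₁ : T.map (F.map (S.η.app c)) ≫ k.psi.app (S.obj c) =
        k.psi.app c ≫ F.map (S.map (S.η.app c)) := k.psi.naturality (S.η.app c)
    have h₂ : F.map (S.map (S.η.app c)) ≫ F.map (S.μ.app c) = 𝟙 _ := by
      rw [← F.map_comp, S.right_unit]
      exact F.map_id _
    rw [reassoc_of% h₁, h₂]
    exact (Category.comp_id _).symm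
  intro c
  have h₃ : A.map (S.η.app c) ≫ θ.app (S.obj c) = θ.app c ≫ B.map (S.η.app c) :=
    θ.naturality (S.η.app c)
  rw [key B g c, key A f c, ← Functor.map_comp_assoc, ← h₃, Functor.map_comp, Category.assoc, h c]
  simp only [Category.assoc]

/-- An adjoint object in the 2-category of monads induces an adjunction between the lifted functors
on algebras, whose unit and counit lie over the given ones. -/
def IsMndAdjointObject.liftAdj {S : Monad C} {T : Monad D} {J : C ⥤ D} {K : D ⥤ C} {adj : J ⊣ K}
    {f : MndOneCell S T J} {g : MndOneCell T S K} (h : IsMndAdjointObject adj f g) :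
    f.lift ⊣ g.lift where
  unit :=
    { app := fun M =>
        { f := adj.unit.app M.A
          h := by
            have h₁ : S.map (adj.unit.app M.A) ≫
                (g.psi.app (J.obj M.A) ≫ K.map (f.psi.app M.A)) ≫ K.map (J.map M.a) =
                (𝟙 _ ≫ M.a) ≫ adj.unit.app M.A := h.unit_cell.lift_map M
            rw [Category.id_comp, Category.assoc, ← K.map_comp] at h₁
            exact h₁ }
      naturality := fun M N m => by ext; exact adj.unit.naturality m.f }
  counit :=
    { app := fun Y =>
        { f := adj.counit.app Y.A
          h := by
            have h₁ : T.map (adj.counit.app Y.A) ≫ 𝟙 _ ≫ Y.a =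
                ((f.psi.app (K.obj Y.A) ≫ J.map (g.psi.app Y.A)) ≫ J.map (K.map Y.a)) ≫
                  adj.counit.app Y.A := h.counit_cell.lift_map Y
            rw [Category.id_comp, Category.assoc (f.psi.app _), ← J.map_comp] at h₁
            exact h₁ }
      naturality := fun M N m => by ext; exact adj.counit.naturality m.f }
  left_triangle_components M := by ext; exact adj.left_triangle_components M.A
  right_triangle_components Y := by ext; exact adj.right_triangle_components Y.A

/-- The converse of `IsMndAdjointObject.liftAdj`: if the unit and the counit are morphisms
between the lifted algebras, the 1-cells form an adjoint object. -/
theorem IsMndAdjointObject.of_algebra_hom {S : Monad C} {T : Monad D} {J : C ⥤ D} {K : D ⥤ C}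
    {adj : J ⊣ K} {f : MndOneCell S T J} {g : MndOneCell T S K}
    (hunit : ∀ M : S.Algebra, S.map (adj.unit.app M.A) ≫ (g.lift.obj (f.lift.obj M)).a =
      M.a ≫ adj.unit.app M.A)
    (hcounit : ∀ Y : T.Algebra, T.map (adj.counit.app Y.A) ≫ Y.a =
      (f.lift.obj (g.lift.obj Y)).a ≫ adj.counit.app Y.A) : IsMndAdjointObject adj f g where
  unit_cell := by
    refine isMndTwoCell_of_free _ _ _ fun c => ?_
    have h₁ : S.map (adj.unit.app (S.obj c)) ≫ g.psi.app (J.obj (S.obj c)) ≫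
        K.map (f.psi.app (S.obj c) ≫ J.map (S.μ.app c)) = S.μ.app c ≫ adj.unit.app (S.obj c) :=
      hunit (S.free.obj c)
    change S.map (adj.unit.app (S.obj c)) ≫
      (g.psi.app (J.obj (S.obj c)) ≫ K.map (f.psi.app (S.obj c))) ≫ K.map (J.map (S.μ.app c)) =
      (𝟙 _ ≫ S.μ.app c) ≫ adj.unit.app (S.obj c)
    rw [Category.id_comp, Category.assoc, ← K.map_comp]
    exact h₁
  counit_cell := by
    refine isMndTwoCell_of_free _ _ _ fun d => ?_
    have h₁ : T.map (adj.counit.app (T.obj d)) ≫ T.μ.app d =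
        (f.psi.app (K.obj (T.obj d)) ≫ J.map (g.psi.app (T.obj d) ≫ K.map (T.μ.app d))) ≫
          adj.counit.app (T.obj d) := hcounit (T.free.obj d)
    change T.map (adj.counit.app (T.obj d)) ≫ 𝟙 _ ≫ T.μ.app d =
      ((f.psi.app (K.obj (T.obj d)) ≫ J.map (g.psi.app (T.obj d))) ≫ J.map (K.map (T.μ.app d))) ≫
        adj.counit.app (T.obj d)
    rw [Category.id_comp, Category.assoc (f.psi.app _), ← J.map_comp]
    exact h₁

/-- The right adjoint of an adjoint object whose left adjoint has an invertible `ψ` is determined: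
its structure is the mate of `ψ⁻¹`. -/
theorem IsMndAdjointObject.psi_eq_ad {S : Monad C} {T : Monad D} {J : C ⥤ D} {K : D ⥤ C}
    {adj : J ⊣ K} {f : MndOneCell S T J} {g : MndOneCell T S K} (h : IsMndAdjointObject adj f g)
    [IsIso f.psi] : g.psi = ad adj f.psi := by
  ext d
  have h₁ : S.map (adj.unit.app (K.obj d)) ≫ g.psi.app (J.obj (K.obj d)) ≫
      K.map (f.psi.app (K.obj d)) = 𝟙 _ ≫ adj.unit.app (S.obj (K.obj d)) := h.unit_cell (K.obj d)
  have h₂ : S.map (K.map (adj.counit.app d)) ≫ g.psi.app d =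
      g.psi.app (J.obj (K.obj d)) ≫ K.map (T.map (adj.counit.app d)) :=
    g.psi.naturality (adj.counit.app d)
  have h₃ : (ad adj f.psi).app d = adj.unit.app (S.obj (K.obj d)) ≫
      K.map ((inv f.psi).app (K.obj d)) ≫ K.map (T.map (adj.counit.app d)) := by
    simp [ad]
  have h₄ : K.map (f.psi.app (K.obj d)) ≫ K.map ((inv f.psi).app (K.obj d)) = 𝟙 _ := by
    rw [← K.map_comp, ← NatTrans.comp_app, IsIso.hom_inv_id]
    exact K.map_id _
  have h₅ : S.map (adj.unit.app (K.obj d)) ≫ S.map (K.map (adj.counit.app d)) = 𝟙 _ := by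
    rw [← S.map_comp, adj.right_triangle_components]
    exact S.map_id _
  rw [Category.id_comp] at h₁
  rw [h₃, ← h₁, Category.assoc, Category.assoc, reassoc_of% h₄, ← h₂, reassoc_of% h₅]

end Mnd

/-! ### Functors on algebras over a functor of two variables -/

section Cells

variable {C : Type u₁} [Category.{v₁} C] {D : Type u₂} [Category.{v₂} D]
  {P : Type u₃} [Category.{v₃} P] {Q : Type u₄} [Category.{v₄} Q]

/-- The inverse of `algProd`: an algebra of `S × E` as a pair of algebras. -/
def algProdInv (S : Monad C) (E : Monad P) : (monadProd S E).Algebra ⥤ S.Algebra × E.Algebra where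
  obj M :=
    ({ A := M.A.1
       a := M.a.1
       unit := congrArg Prod.fst M.unit
       assoc := congrArg Prod.fst M.assoc },
     { A := M.A.2
       a := M.a.2
       unit := congrArg Prod.snd M.unit
       assoc := congrArg Prod.snd M.assoc })
  map m := ({ f := m.f.1, h := congrArg Prod.fst m.h }, { f := m.f.2, h := congrArg Prod.snd m.h })

/-- An algebra of `1 × T` as an object of the product of `Q` and the algebras of `T`. -/
def idAlgProdInv (Q : Type u₄) [Category.{v₄} Q] (T : Monad D) :
    (monadProd (Monad.id Q) T).Algebra ⥤ Q × T.Algebra where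
  obj M :=
    (M.A.1,
     { A := M.A.2
       a := M.a.2
       unit := congrArg Prod.snd M.unit
       assoc := congrArg Prod.snd M.assoc })
  map m := (m.f.1, { f := m.f.2, h := congrArg Prod.snd m.h })

/-- The action of `T` on `B U^S` given by a 1-cell `(B, ψ)`. -/
def MndOneCell.toAction {S : Monad C} {T : Monad D} {B : C ⥤ D} (f : MndOneCell S T B) :
    MonadAction T (S.forget ⋙ B) :=
  MonadAction.ofFunctor f.lift

theorem MndOneCell.toCell_toAction {S : Monad C} {T : Monad D} {B : C ⥤ D}
    (f : MndOneCell S T B) : f.toAction.toCell = f := by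
  ext c
  have h₁ : T.map (B.map (S.η.app c)) ≫ f.psi.app (S.obj c) =
      f.psi.app c ≫ B.map (S.map (S.η.app c)) := f.psi.naturality (S.η.app c)
  change T.map (B.map (S.η.app c)) ≫ f.psi.app (S.obj c) ≫ B.map (S.μ.app c) = f.psi.app c
  rw [reassoc_of% h₁, ← B.map_comp, S.right_unit]
  exact (congrArg (f.psi.app c ≫ ·) (B.map_id _)).trans (Category.comp_id _)

/-- The 1-cell `(J, ψ) : (C × P, S × E) ⟶ (D, T)` of an action of `T` on `J(U^S × U^E)`. -/
def MonadAction.toProdCell {S : Monad C} {E : Monad P} {T : Monad D} {J : C × P ⥤ D}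
    (α : MonadAction T (S.forget.prod E.forget ⋙ J)) : MndOneCell (monadProd S E) T J :=
  MonadAction.toCell (W := monadProd S E) (B := J) (α.precomp (algProdInv S E))

/-- The action of `T` on `J(U^S × U^E)` given by a 1-cell `(J, ψ)`. -/
def MndOneCell.toProdAction {S : Monad C} {E : Monad P} {T : Monad D} {J : C × P ⥤ D}
    (f : MndOneCell (monadProd S E) T J) : MonadAction T (S.forget.prod E.forget ⋙ J) :=
  f.toAction.precomp (algProd S E)

theorem MndOneCell.toProdCell_toProdAction {S : Monad C} {E : Monad P} {T : Monad D}
    {J : C × P ⥤ D} (f : MndOneCell (monadProd S E) T J) : f.toProdAction.toProdCell = f :=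
  f.toCell_toAction

theorem MonadAction.toProdAction_toProdCell {S : Monad C} {E : Monad P} {T : Monad D}
    {J : C × P ⥤ D} (α : MonadAction T (S.forget.prod E.forget ⋙ J)) :
    α.toProdCell.toProdAction = α := by
  ext x
  exact MonadAction.toCell_psi_comp_map (W := monadProd S E) (B := J)
    (α.precomp (algProdInv S E)) ((algProd S E).obj x)

/-- The functor `[J(C × U^E)]^{H(ψ)}` on algebras. -/
abbrev MndOneCell.hopfLift {S : Monad C} {E : Monad P} {T : Monad D} {J : C × P ⥤ D}
    (f : MndOneCell (monadProd S E) T J) : S.Algebra × E.Algebra ⥤ T.Algebra :=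
  (𝟭 S.Algebra).prod (idAlg E.Algebra) ⋙ algProd S (Monad.id E.Algebra) ⋙ f.hopf.lift

/-- The functor on algebras induced by a 1-cell `(B, β) : (Q × D, 1 × T) ⟶ (C, S)`. -/
abbrev MndOneCell.rightLift {S : Monad C} {T : Monad D} {B : Q × D ⥤ C}
    (g : MndOneCell (monadProd (Monad.id Q) T) S B) : Q × T.Algebra ⥤ S.Algebra :=
  (idAlg Q).prod (𝟭 T.Algebra) ⋙ algProd (Monad.id Q) T ⋙ g.lift

/-- Acting in the `C`-variable after `H(ψ)` is the action `J(M, N) ∘ ψ` in both variables. -/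
theorem MndOneCell.hopfLift_eq {S : Monad C} {E : Monad P} {T : Monad D} {J : C × P ⥤ D}
    (f : MndOneCell (monadProd S E) T J) : f.hopfLift = f.toProdAction.toFunctor := by
  change (MonadAction.ofFunctor f.hopfLift).toFunctor = _
  refine congrArg (MonadAction.toFunctor (B := S.forget.prod E.forget ⋙ J)) ?_
  ext ⟨M, N⟩
  change (f.psiAt M.A N.A ≫ bimap J (𝟙 (S.obj M.A)) N.a) ≫ bimap J M.a (𝟙 N.A) =
    f.psiAt M.A N.A ≫ bimap J M.a N.a
  rw [Category.assoc, bimap_comp, Category.id_comp, Category.comp_id]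

/-- Every lifting of `J` to algebras is `[J(C × U^E)]^{H(ψ)}` for a 1-cell `(J, ψ)`. -/
theorem exists_eq_hopfLift {S : Monad C} {E : Monad P} {T : Monad D} {J : C × P ⥤ D}
    (V : S.Algebra × E.Algebra ⥤ T.Algebra) (h : V ⋙ T.forget = S.forget.prod E.forget ⋙ J) :
    ∃ f : MndOneCell (monadProd S E) T J, V = f.hopfLift := by
  obtain ⟨α, rfl⟩ := MonadAction.exists_eq_toFunctor V h
  exact ⟨α.toProdCell, by rw [MndOneCell.hopfLift_eq, α.toProdAction_toProdCell]⟩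

/-- Every lifting of `B : Q × D ⥤ C` to algebras is induced by a 1-cell from `1 × T` to `S`. -/
theorem exists_eq_rightLift {S : Monad C} {T : Monad D} {B : Q × D ⥤ C}
    (V : Q × T.Algebra ⥤ S.Algebra) (h : V ⋙ S.forget = (𝟭 Q).prod T.forget ⋙ B) :
    ∃ g : MndOneCell (monadProd (Monad.id Q) T) S B, V = g.rightLift := by
  obtain ⟨β, rfl⟩ := MonadAction.exists_eq_toFunctor V h
  refine ⟨MonadAction.toCell (W := monadProd (Monad.id Q) T) (B := B)
    (β.precomp (idAlgProdInv Q T)), ?_⟩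
  change _ = (MonadAction.ofFunctor (MndOneCell.rightLift _)).toFunctor
  refine congrArg (MonadAction.toFunctor (B := (𝟭 Q).prod T.forget ⋙ B)) ?_
  ext ⟨N, Y⟩
  exact (MonadAction.toCell_psi_comp_map (W := monadProd (Monad.id Q) T) (B := B)
    (β.precomp (idAlgProdInv Q T)) ((algProd (Monad.id Q) T).obj ((idAlg Q).obj N, Y))).symm

end Cells

/-! ### The 1-cell of adjunctions of a lifting -/

section Adj

variable {C : Type u₁} [Category.{v₁} C] {D : Type u₂} [Category.{v₂} D]
  {P : Type u₃} [Category.{v₃} P] {X : Type u₄} [Category.{v₄} X] {Y : Type u₅} [Category.{v₅} Y]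

theorem AdjOneCell.ofComm_lam_app {L : C ⥤ X} {R : X ⥤ C} (a : L ⊣ R) {L' : D ⥤ Y} {R' : Y ⥤ D}
    (a' : L' ⊣ R') {J : C ⥤ D} {V : X ⥤ Y} (h : V ⋙ R' = R ⋙ J) (c : C) :
    (AdjOneCell.ofComm a a' h).lam.app c =
      L'.map (J.map (a.unit.app c)) ≫ L'.map ((eqToHom h.symm).app (L.obj c)) ≫
        a'.counit.app (V.obj (L.obj c)) := by
  have key (β : R ⋙ J ⟶ V ⋙ R') :
      ((mateEquiv a a').symm (TwoSquare.mk _ _ _ _ β)).natTrans.app c =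
        L'.map (J.map (a.unit.app c)) ≫ L'.map (β.app (L.obj c)) ≫
          a'.counit.app (V.obj (L.obj c)) := by simp
  exact key _

theorem AdjOneCell.ofComm_rho_hom {L : C ⥤ X} {R : X ⥤ C} (a : L ⊣ R) {L' : D ⥤ Y} {R' : Y ⥤ D}
    (a' : L' ⊣ R') {J : C ⥤ D} {V : X ⥤ Y} (h : V ⋙ R' = R ⋙ J) :
    (AdjOneCell.ofComm a a' h).rho.hom = eqToHom h.symm :=
  congrArg TwoSquare.natTrans
    ((mateEquiv a a').apply_symm_apply (TwoSquare.mk _ _ _ _ (eqToHom h.symm)))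

theorem AdjOneCell.ofComm_phi_app {L : C ⥤ X} {R : X ⥤ C} (a : L ⊣ R) {L' : D ⥤ Y} {R' : Y ⥤ D}
    (a' : L' ⊣ R') {J : C ⥤ D} {V : X ⥤ Y} (h : V ⋙ R' = R ⋙ J) (c : C) :
    (AdjOneCell.ofComm a a' h).phi.app c =
      R'.map ((AdjOneCell.ofComm a a' h).lam.app c) ≫ (eqToHom h).app (L.obj c) := by
  have h₁ : (AdjOneCell.ofComm a a' h).rho.inv = eqToHom h := by
    rw [← cancel_epi (AdjOneCell.ofComm a a' h).rho.hom, Iso.hom_inv_id, ofComm_rho_hom,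
      eqToHom_trans, eqToHom_refl]
  simp [phi, h₁]

/-- Over a strictly commutative square given by an action, the underlying map of `λ` is the action
on free objects after the unit. -/
theorem AdjOneCell.ofComm_lam_app_f {L : C ⥤ X} {R : X ⥤ C} (a : L ⊣ R) {T : Monad D} {J : C ⥤ D}
    (α : MonadAction T (R ⋙ J)) (h : α.toFunctor ⋙ T.forget = R ⋙ J) (c : C) :
    ((AdjOneCell.ofComm a T.adj h).lam.app c).f =
      T.map (J.map (a.unit.app c)) ≫ α.act.app (L.obj c) := by
  have h₁ : (T.adj.counit.app (α.toFunctor.obj (L.obj c))).f = α.act.app (L.obj c) := by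
    rw [Monad.adj_counit]
    rfl
  rw [ofComm_lam_app]
  refine congrArg (T.map (J.map (a.unit.app c)) ≫ ·) ?_
  exact (congrArg₂ (· ≫ ·) (T.map_id _) h₁).trans (Category.id_comp _)

section Prod

variable {S : Monad C} {E : Monad P} {T : Monad D} {J : C × P ⥤ D}

/-- For the lifting given by a 1-cell `(J, ψ)`, the transformation underlying `λ` is `ψ`. -/
theorem hopfLift_lam_app_f (f : MndOneCell (monadProd S E) T J)
    (h : f.hopfLift ⋙ T.forget = S.forget.prod E.forget ⋙ J) (x : C × P) :
    ((AdjOneCell.ofComm (adjProd S.adj E.adj) T.adj h).lam.app x).f = f.psi.app x := by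
  have key (V : S.Algebra × E.Algebra ⥤ T.Algebra) (hV : V = f.toProdAction.toFunctor)
      (h : V ⋙ T.forget = S.forget.prod E.forget ⋙ J) :
      (T.forget.map ((AdjOneCell.ofComm (adjProd S.adj E.adj) T.adj h).lam.app x) ≫
        (eqToHom h).app _) = f.psi.app x := by
    -- After the substitution the two sides of `h` agree definitionally, so its `eqToHom` is `𝟙`.
    subst hV
    refine (Category.comp_id _).trans ?_
    refine (AdjOneCell.ofComm_lam_app_f _ _ h x).trans ?_
    have h₁ : (adjProd S.adj E.adj).unit.app x = (monadProd S E).η.app x := by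
      simp only [adjProd, monadProd, Monad.adj_unit]
      rfl
    rw [h₁]
    exact NatTrans.congr_app (congrArg MndOneCell.psi f.toProdCell_toProdAction) x
  exact (Category.comp_id _).symm.trans (key _ f.hopfLift_eq h)

/-- `Φ(λ) = ψ` for the lifting given by a 1-cell `(J, ψ)`. -/
theorem hopfLift_phi_app (f : MndOneCell (monadProd S E) T J)
    (h : f.hopfLift ⋙ T.forget = S.forget.prod E.forget ⋙ J) (x : C × P) :
    (AdjOneCell.ofComm (adjProd S.adj E.adj) T.adj h).phi.app x = f.psi.app x := by
  rw [AdjOneCell.ofComm_phi_app]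
  exact (Category.comp_id _).trans (hopfLift_lam_app_f f h x)

/-- A 1-cell `(J, ψ)` is left Hopf if and only if its lifting is: `U^T` sends `H(λ)` to `H(ψ)` and
reflects isomorphisms. -/
theorem isHopf_ofComm_hopfLift_iff (f : MndOneCell (monadProd S E) T J)
    (h : f.hopfLift ⋙ T.forget = S.forget.prod E.forget ⋙ J) :
    (AdjOneCell.ofComm (adjProd S.adj E.adj) T.adj h).IsHopf ↔ f.IsHopf := by
  have key (x : C × E.Algebra) :
      T.forget.map ((AdjOneCell.ofComm (adjProd S.adj E.adj) T.adj h).hopf.app x) =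
        f.hopf.psi.app x := by
    have h₁ := hopfLift_lam_app_f f h (x.1, x.2.A)
    have h₂ : (E.adj.counit.app x.2).f = x.2.a := by rw [Monad.adj_counit]
    change ((AdjOneCell.ofComm (adjProd S.adj E.adj) T.adj h).lam.app (x.1, x.2.A)).f ≫
      bimap J (𝟙 (S.obj x.1)) (E.adj.counit.app x.2).f =
        f.psiAt x.1 x.2.A ≫ bimap J (𝟙 (S.obj x.1)) x.2.a
    rw [h₁, h₂]
    rfl
  unfold AdjOneCell.IsHopf MndOneCell.IsHopf
  rw [NatTrans.isIso_iff_isIso_app, NatTrans.isIso_iff_isIso_app]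
  refine forall_congr' fun x => ?_
  rw [← key x]
  exact (isIso_iff_of_reflects_iso _ T.forget).symm

end Prod

end Adj

/-! ### The bijection -/

section Main

variable {C : Type u₁} [Category.{v₁} C] {D : Type u₂} [Category.{v₂} D]
  {P : Type u₃} [Category.{v₃} P] {J : C × P ⥤ D} {K : Pᵒᵖ × D ⥤ C} {a : ParamAdj J K}
  {S : Monad C} {T : Monad D} {E : Monad P}

/-- A Hopf parametric adjoint lifting is determined by its functors: the forgetful functors are
faithful, so its units are determined by those of `J ⊣_P K`. -/
theorem HopfParamLifting.ext_functors {l l' : HopfParamLifting S E T a}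
    (hJ : l.Jhat = l'.Jhat) (hK : l.Khat = l'.Khat) : l = l' := by
  obtain ⟨Jhat, Khat, ⟨adj, h⟩, commJ, commK, hu, hc, hh⟩ := l
  obtain ⟨Jhat', Khat', ⟨adj', h'⟩, commJ', commK', hu', hc', hh'⟩ := l'
  obtain rfl : Jhat = Jhat' := hJ
  obtain rfl : Khat = Khat' := hK
  obtain rfl : adj = adj' := by
    funext N
    ext M
    exact (hu M N).trans (hu' M N).symm
  rfl

/-- A Hopf parametric adjunction in the 2-category of monads is determined by `ψ`. -/
theorem HopfParamAdjunction.ext_cell {h h' : HopfParamAdjunction S E T a}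
    (hcell : h.cell = h'.cell) : h = h' := by
  obtain ⟨cell, hopf, cocell, heq, hadj⟩ := h
  obtain ⟨cell', hopf', cocell', heq', hadj'⟩ := h'
  obtain rfl : cell = cell' := hcell
  obtain rfl : cocell = cocell' := by
    ext ⟨N, d⟩
    exact NatTrans.congr_app ((heq N.unop).trans (heq' N.unop).symm) d
  rfl

/-- The lifting given by a Hopf parametric adjunction in the 2-category of monads. -/
def HopfParamAdjunction.toLifting (h : HopfParamAdjunction S E T a) :
    HopfParamLifting S E T a where
  Jhat := h.cell.hopfLift
  Khat := h.cocell.rightLift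
  adjHat :=
    { adj := fun N => (h.adjoint N).liftAdj
      unit_whiskerRight_map := fun {N N'} n => by
        ext M
        exact NatTrans.congr_app ((a.restrict E.forget).unit_whiskerRight_map n) M.A }
  commJ := rfl
  commK := rfl
  -- `commJ` and `commK` hold definitionally, so each `eqToHom` is definitionally an identity.
  unit_lift M N := by
    change (a.adj N.A).unit.app M.A = _
    refine (Category.comp_id _).symm.trans (congrArg ((a.adj N.A).unit.app M.A ≫ ·) ?_)
    exact ((Category.comp_id _).trans ((fixL K N.A).map_id _)).symm
  counit_lift N Y := by
    refine (Category.id_comp _).trans ((Category.id_comp _).symm.trans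
      (congrArg (· ≫ (a.adj N.A).counit.app Y.A) ?_))
    exact ((fixR J N.A).map_id _).symm
  hopf := (isHopf_ofComm_hopfLift_iff h.cell rfl).2 h.isHopf

theorem HopfParamAdjunction.toLifting_phi_app (h : HopfParamAdjunction S E T a) (x : C × P) :
    h.toLifting.oneCell.phi.app x = h.cell.psi.app x :=
  hopfLift_phi_app h.cell _ x

theorem HopfParamAdjunction.toLifting_injective :
    Function.Injective (toLifting : HopfParamAdjunction S E T a → HopfParamLifting S E T a) := by
  intro h h' hh
  refine ext_cell ?_
  ext x
  rw [← h.toLifting_phi_app, ← h'.toLifting_phi_app, hh]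

/-- Every lifting comes from a Hopf parametric adjunction of monads: its functors are induced by
1-cells, its unit and counit are morphisms of algebras, which makes these 1-cells an adjoint object,
and this forces the structure of the right adjoint to be `ad(H(ψ))`. -/
theorem HopfParamAdjunction.toLifting_surjective :
    Function.Surjective (toLifting : HopfParamAdjunction S E T a → HopfParamLifting S E T a) := by
  intro l
  obtain ⟨f, hf⟩ := exists_eq_hopfLift l.Jhat l.commJ
  obtain ⟨g, hg⟩ := exists_eq_rightLift (B := E.forget.op.prod (𝟭 D) ⋙ K) l.Khat l.commK
  suffices ∃ h : HopfParamAdjunction S E T a, h.cell = f ∧ h.cocell = g by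
    obtain ⟨h, rfl, rfl⟩ := this
    exact ⟨h, HopfParamLifting.ext_functors hf.symm hg.symm⟩
  obtain ⟨Jhat, Khat, adjHat, commJ, commK, hu, hc, hh⟩ := l
  obtain rfl : Jhat = _ := hf
  obtain rfl : Khat = _ := hg
  have hopf : f.IsHopf := (isHopf_ofComm_hopfLift_iff f commJ).1 hh
  -- The lifted functors now lie definitionally over the given ones, so the `eqToHom`s in the
  -- unit and counit conditions are identities.
  have hu' (M : S.Algebra) (N : E.Algebra) :
      ((adjHat.adj N).unit.app M).f = (a.adj N.A).unit.app M.A := by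
    refine (hu M N).trans ((congrArg ((a.adj N.A).unit.app M.A ≫ ·) ?_).trans
      (Category.comp_id _))
    exact (Category.comp_id _).trans ((fixL K N.A).map_id _)
  have hc' (N : E.Algebra) (Y : T.Algebra) :
      ((adjHat.adj N).counit.app Y).f = (a.adj N.A).counit.app Y.A := by
    refine (Category.id_comp _).symm.trans ((hc N Y).trans
      ((congrArg (· ≫ (a.adj N.A).counit.app Y.A) ?_).trans (Category.id_comp _)))
    exact (fixR J N.A).map_id _
  have hadj : IsMndParamAdjointObject (a.restrict E.forget) f.hopf g := fun N =>
    IsMndAdjointObject.of_algebra_hom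
      (fun M => by
        have h₁ := ((adjHat.adj N).unit.app M).h
        rw [hu' M N] at h₁
        exact h₁)
      (fun Y => by
        have h₁ := ((adjHat.adj N).counit.app Y).h
        rw [hc' N Y] at h₁
        exact h₁)
  exact ⟨{ cell := f, isHopf := hopf, cocell := g, adjoint := hadj
           cocell_eq := fun N => haveI := hopf.fixRight N; (hadj N).psi_eq_ad }, rfl, rfl⟩

end Main

end

end HopfParam

open HopfParam in
/-- Hopf parametric adjoint liftings of a parametric adjunction `J ⊣_P K` to Eilenberg–Moore
categories correspond bijectively to Hopf parametric adjunctions over it in the 2-category of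
monads: a lifting is sent to the 1-cell `ψ = Φ(λ)`, and the functors of the lifting which belongs
to `ψ` are those which `H(ψ)` and `ad(H(ψ))` induce on algebras. -/
theorem theorem6p2p1 {C : Type u₁} [Category.{v₁} C] {D : Type u₂} [Category.{v₂} D]
    {P : Type u₃} [Category.{v₃} P] {J : C × P ⥤ D} {K : Pᵒᵖ × D ⥤ C} (a : ParamAdj J K)
    (S : Monad C) (T : Monad D) (E : Monad P) :
    ∃ e : HopfParamLifting S E T a ≃ HopfParamAdjunction S E T a,
      (∀ (l : HopfParamLifting S E T a) (x : C × P),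
        (e l).cell.psi.app x = l.oneCell.phi.app x) ∧
      (∀ h : HopfParamAdjunction S E T a,
        (e.symm h).Jhat =
            (𝟭 S.Algebra).prod (idAlg E.Algebra) ⋙ algProd S (Monad.id E.Algebra) ⋙
              h.cell.hopf.lift ∧
          (e.symm h).Khat =
            (idAlg E.Algebraᵒᵖ).prod (𝟭 T.Algebra) ⋙ algProd (Monad.id E.Algebraᵒᵖ) T ⋙
              h.cocell.lift) := by
  let g : HopfParamAdjunction S E T a ≃ HopfParamLifting S E T a :=
    Equiv.ofBijective HopfParamAdjunction.toLifting
      ⟨HopfParamAdjunction.toLifting_injective, HopfParamAdjunction.toLifting_surjective⟩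
  refine ⟨g.symm, fun l x => ?_, fun h => ⟨rfl, rfl⟩⟩
  obtain ⟨h, rfl⟩ := g.surjective l
  rw [g.symm_apply_apply]
  exact (h.toLifting_phi_app x).symm
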